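/- Let $p\ge 1$, let $g_2,g_4,\dots,g_{2p}$ be real with $g_{2p}>0$, and let $V(\lambda)=\sum_{j=1}^p g_{2j}\lambda^j$ (an even potential in $z$, where $\lambda=z^2$) and $W(r)=\sum_{k=1}^p\binom{2k}{k}\,k\,g_{2k}\,r^k$. Let $m\ge 2$ and let $(r_c,T_c)\in\mathbb R^2$ be a singular solution of order $m$ of the hodograph equation $W(r)=T$, i.e. $W(r_c)=T_c$, $W'(r_c)=\dots=W^{(m-1)}(r_c)=0$ and $W^{(m)}(r_c)\ne 0$. Let $\Omega\subseteq\mathbb R$ be open, let $\mathfrak r_k$ $(k\ge 1)$ be real functions that are smooth on $\Omega$, and let $r(\bar\epsilon,x)=r_c+\sum_{k\ge1}\mathfrak r_k(x)\,\bar\epsilon^{2k}$ be the corresponding formal power series in $\bar\epsilon$. For $i\in\mathbb Z$ let $r_{[i]}(\bar\epsilon,x)=r(\bar\epsilon,x+i\bar\epsilon)$, understood through the formal Taylor expansion in $\bar\epsilon$. Let $L$ be the operator $L v_i=v_{i+1}+r_{[i]}v_{i-1}$ $(i\in\mathbb Z)$ on the free module with basis $(v_i)_{i\in\mathbb Z}$,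 and let $$U(\lambda)=1+2\sum_{k\ge1}(L^{2k-1})_{0,-1}\,\lambda^{-k},$$ where $(L^{j})_{0,-1}$ is the coefficient of $v_{-1}$ in $L^jv_0$. Suppose that $r$ solves the scaled string equation $$\oint\frac{d\lambda}{2\pi i}\,V_\lambda(\lambda)\,U(\lambda)=T_c+\bar\epsilon^{2m}x\qquad(x\in\Omega)$$ as formal power series in $\bar\epsilon$, where the left-hand side is the coefficient of $\lambda^{-1}$ in $V_\lambda U$. Then there is exactly one sequence $R_0,R_1,R_2,\dots$ of differential polynomials in $u$ (polynomials in $u,u_x,u_{xx},\dots$ with real coefficients) such that $R_0=1$, $$\partial_xR_{n+1}=(r_c\,\partial_x^3+4u\,\partial_x+2u_x)R_n\qquad(n\ge0),$$ and $R_n$ has zero constant term for all $n\ge1$; and $u=\mathfrak r_1$ satisfies the $(m-1)$-th Painlevé I equation $$c_m(r_c)\,R_m(u)=x\quad\text{on }\Omega,\qquad c_m(r_c)=\frac{W^{(m)}(r_c)}{2^m(2m-1)!!}.$$ -/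

import Mathlib

open scoped ContDiff Nat

noncomputable section

namespace DoubleScaling

/-- The even potential `V(λ) = ∑_{j=1}^p g_{2j} λ^j`, as a polynomial in `λ = z²`; `g j` is the
coupling constant `g_{2j}`. -/
def potential (p : ℕ) (g : ℕ → ℝ) : Polynomial ℝ :=
  ∑ j ∈ Finset.Icc 1 p, Polynomial.C (g j) * Polynomial.X ^ j

/-- The hodograph function `W(r) = ∑_{k=1}^p (2k choose k) k g_{2k} r^k`. -/
def hodograph (p : ℕ) (g : ℕ → ℝ) (r : ℝ) : ℝ :=
  ∑ k ∈ Finset.Icc 1 p, ((2 * k).choose k : ℝ) * k * g k * r ^ k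

/-- `(r_c, T_c)` is a singular solution of order `m ≥ 2` of the hodograph equation `W(r) = T`. -/
structure IsSingularSolution (W : ℝ → ℝ) (rc Tc : ℝ) (m : ℕ) : Prop where
  two_le : 2 ≤ m
  value : W rc = Tc
  vanish : ∀ k, 1 ≤ k → k < m → iteratedDeriv k W rc = 0
  nonzero : iteratedDeriv m W rc ≠ 0

/-- `c_m(r_c) = W^{(m)}(r_c) / (2^m (2m-1)!!)`. -/
def criticalConst (W : ℝ → ℝ) (rc : ℝ) (m : ℕ) : ℝ :=
  iteratedDeriv m W rc / (2 ^ m * ((2 * m - 1)‼ : ℕ))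

/-- Formal power series in the scaled parameter `ε̄` whose coefficients are functions of the
scaling variable `x`. -/
abbrev ScaledSeries : Type := PowerSeries (ℝ → ℝ)

/-- The shift `f_{[i]}(x) = f(x + i ε̄)`, that is, the formal Taylor expansion
`∑_j (i ε̄)^j / j! ∂_x^j f`. -/
def shift (i : ℤ) (F : ScaledSeries) : ScaledSeries :=
  PowerSeries.mk fun n => ∑ j ∈ Finset.range (n + 1),
    ((i : ℝ) ^ j / (j ! : ℕ)) • iteratedDeriv j (PowerSeries.coeff (n - j) F)

/-- The series `r(ε̄, x) = r_c + ∑_{k ≥ 1} 𝔯_k(x) ε̄^{2k}` (the value `𝔯 0` is not used). -/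
def recurrenceSeries (rc : ℝ) (𝔯 : ℕ → ℝ → ℝ) : ScaledSeries :=
  PowerSeries.mk fun n => if n = 0 then fun _ => rc else if Even n then 𝔯 (n / 2) else 0

/-- The continuum limit of the Lax operator `L v_n = v_{n+1} + r_n v_{n-1}`: the basis vector
`Finsupp.single i 1` stands for `v_{n+i}`, and `r_{n+i}` becomes the shifted series `r_{[i]}`. -/
def laxOperator (r : ScaledSeries) : Module.End ScaledSeries (ℤ →₀ ScaledSeries) :=
  Finsupp.linearCombination ScaledSeries fun i : ℤ =>
    Finsupp.single (i + 1) (1 : ScaledSeries) + shift i r • Finsupp.single (i - 1) 1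

/-- The generating function `U(λ) = 1 + 2 ∑_{k ≥ 1} (L^{2k-1})_{n,n-1} λ^{-k}`, as a formal power
series in `λ^{-1}` (the outer variable). -/
def generatingFunction (r : ScaledSeries) : PowerSeries ScaledSeries :=
  PowerSeries.mk fun k =>
    if k = 0 then 1 else 2 * ((laxOperator r ^ (2 * k - 1)) (Finsupp.single 0 1)) (-1)

/-- The contour integral `∮ dλ/(2πi) Q(λ) U(λ)` over a large positive circle, that is, the
coefficient of `λ^{-1}` in `Q(λ) U(λ)`, for a polynomial `Q` and a power series `U` in `λ^{-1}`. -/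
def contour (Q : Polynomial ℝ) (U : PowerSeries ScaledSeries) : ScaledSeries :=
  Q.sum fun j a => a • PowerSeries.coeff (j + 1) U

/-- The scaled string equation `∮ dλ/(2πi) V_λ(λ) U(λ, ε̄; r) = T_c + ε̄^{2m} x`, as an identity of
formal power series in `ε̄` for `x ∈ Ω`. -/
def StringEquation (V : Polynomial ℝ) (Tc : ℝ) (m : ℕ) (Ω : Set ℝ) (r : ScaledSeries) : Prop :=
  ∀ n : ℕ, ∀ x ∈ Ω,
    PowerSeries.coeff n (contour (Polynomial.derivative V) (generatingFunction r)) x =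
      PowerSeries.coeff n
        (PowerSeries.C (fun _ => Tc) + PowerSeries.X ^ (2 * m) * PowerSeries.C (fun y => y) :
          ScaledSeries) x

/-- Differential polynomials in `u` with real coefficients: the variable `X i` is `∂_x^i u`. -/
abbrev DiffPoly : Type := MvPolynomial ℕ ℝ

/-- The total derivative `∂_x` on differential polynomials. -/
def totalDeriv : Derivation ℝ DiffPoly DiffPoly :=
  MvPolynomial.mkDerivation ℝ fun i => MvPolynomial.X (i + 1)

/-- The value at `x` of the differential polynomial `P` on the function `u`. -/
def DiffPoly.evalAt (P : DiffPoly) (u : ℝ → ℝ) (x : ℝ) : ℝ :=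
  MvPolynomial.eval (fun i => iteratedDeriv i u x) P

/-- `R` is the sequence of Gel'fand-Dikii differential polynomials: `R_0 = 1`,
`∂_x R_{n+1} = (r_c ∂_x³ + 4 u ∂_x + 2 u_x) R_n`, with zero constants of integration. -/
structure IsGelfandDikii (rc : ℝ) (R : ℕ → DiffPoly) : Prop where
  zero : R 0 = 1
  succ : ∀ n, totalDeriv (R (n + 1)) =
    rc • totalDeriv (totalDeriv (totalDeriv (R n)))
      + 4 * MvPolynomial.X 0 * totalDeriv (R n) + 2 * MvPolynomial.X 1 * R n
  normalized : ∀ n, MvPolynomial.constantCoeff (R (n + 1)) = 0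

end DoubleScaling

end

open DoubleScaling

/-!
The proof compares two quadratic equations. Write `y = λ⁻¹`, and let `Y₊`, `Y₋` denote the
translates of a series `Y` by `±ε`.

* For arbitrary weights `r_n`, the series `U_n` satisfies the lattice equation
  `U_n² = 1 + y r_n (U_n + U_{n+1}) (U_n + U_{n-1})` (`diagonalResolvent_sq`). Comparing `L^{2k} L`
  with `L L^{2k}` gives a linear equation which makes the deviation from the quadratic equation
  independent of `n`; as each coefficient involves finitely many weights only, the weights may be
  cut off far away, and there the deviation vanishes. In the continuum limit the neighbours of `U`
  are `U₊` and `U₋`.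

* An equation `Y² = 1 + w Q(Y)`, in which the coefficient of `w^n` in `Q(Y)` involves only
  the coefficients of `Y` up to that of `w^n`, has exactly one solution with `Y(0) = 1`
  (`sq_eq_unique`,
  `exists_sq_eq`). The generating series `∑ R_n wⁿ` of the Gel'fand–Dikii polynomials is the
  solution of `Y² = 1 + w (rc (2 Y Y'' - Y'²) + 4 u Y²)`: differentiating this equation and
  cancelling `2 Y` gives the recursion for `R_n` (`coeffMap_eq_of_sq_eq`). Uniqueness of `R_n` holds
  since only constants have vanishing total derivative (`eq_C_of_totalDeriv_eq_zero`).

With `r = rc + ε² ρ` and `w = y / (1 - 4 rc y)`, the substitution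
`U = (1 - 4 rc y)^(-1/2) Y(ε² w)` turns the lattice equation into `Y² = 1 + w Q(Y)`, where
`Q(Y) = ε⁻² (r (Y + Y₊) (Y + Y₋) - 4 rc Y²)` is free of negative powers of `ε`
(`diagonalResolvent_eq`). At `ε = 0` this becomes the Gel'fand–Dikii equation for `u = 𝔯₁`, so that
the coefficients of `Y` are `R_k(𝔯₁) + O(ε)`. The term of order `k` in `w` enters `U` with the
factor
`ε^{2k}`, and its contour integral against `V_λ` is a multiple of `W^{(k)}(rc)`
(`iteratedDeriv_hodograph`). In the string equation at order `ε^{2m}` the terms with `k < m` vanish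
because the solution is singular of order `m`, and the term `k = m` is `c_m R_m(𝔯₁)`.

All identities hold in the differential algebra generated by the jets of the `𝔯_k`; evaluating the
jets at a point of `Ω` gives the statement about functions.
-/

open scoped ContDiff Nat

noncomputable section

namespace DoubleScaling

open PowerSeries

/-! ### Quadratic fixed-point equations for power series -/

/-- A map applied to each coefficient of a power series. -/
def coeffMap {B C : Type*} [Semiring B] [Semiring C] (f : B → C) (Y : B⟦X⟧) : C⟦X⟧ :=
  PowerSeries.mk fun n => f (coeff n Y)

@[simp]
theorem coeff_coeffMap {B C : Type*} [Semiring B] [Semiring C] (f : B → C) (Y : B⟦X⟧) (n : ℕ) :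
    coeff n (coeffMap f Y) = f (coeff n Y) :=
  coeff_mk _ _

theorem X_pow_dvd_sub_iff {B : Type*} [CommRing B] {n : ℕ} {Y Z : B⟦X⟧} :
    (X : B⟦X⟧) ^ n ∣ Y - Z ↔ ∀ k < n, coeff k Y = coeff k Z := by
  simp [X_pow_dvd_iff, sub_eq_zero]

theorem eq_of_forall_X_pow_dvd_sub {B : Type*} [CommRing B] {Y Z : B⟦X⟧}
    (h : ∀ n, (X : B⟦X⟧) ^ n ∣ Y - Z) : Y = Z := by
  ext n
  exact X_pow_dvd_sub_iff.1 (h (n + 1)) n n.lt_succ_self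

/-- An operator on power series is causal if the coefficients of index `< n` of its value depend
only on the coefficients of index `< n` of its argument. -/
def Causal {B C : Type*} [CommRing B] [CommRing C] (Q : B⟦X⟧ → C⟦X⟧) : Prop :=
  ∀ (n : ℕ) (Y Z : B⟦X⟧), (X : B⟦X⟧) ^ n ∣ Y - Z → (X : C⟦X⟧) ^ n ∣ Q Y - Q Z

namespace Causal

variable {B C : Type*} [CommRing B] [CommRing C]

theorem id : Causal (fun Y : B⟦X⟧ => Y) := fun _ _ _ h => h

theorem const (c : C⟦X⟧) : Causal (fun _ : B⟦X⟧ => c) := fun _ _ _ _ => by simp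

theorem coeffMap (f : B → C) : Causal (DoubleScaling.coeffMap f) := fun n Y Z h => by
  rw [X_pow_dvd_sub_iff] at h ⊢
  intro k hk
  simp [h k hk]

theorem map (f : B →+* C) : Causal (PowerSeries.map f) := fun n Y Z h => by
  rw [X_pow_dvd_sub_iff] at h ⊢
  intro k hk
  simp [h k hk]

theorem add {P Q : B⟦X⟧ → C⟦X⟧} (hP : Causal P) (hQ : Causal Q) :
    Causal (fun Y => P Y + Q Y) := fun n Y Z h => by
  have := dvd_add (hP n Y Z h) (hQ n Y Z h)
  convert this using 1
  ring

theorem mul {P Q : B⟦X⟧ → C⟦X⟧} (hP : Causal P) (hQ : Causal Q) :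
    Causal (fun Y => P Y * Q Y) := fun n Y Z h => by
  have := dvd_add ((hP n Y Z h).mul_right (Q Y)) ((hQ n Y Z h).mul_left (P Z))
  convert this using 1
  ring

theorem sub {P Q : B⟦X⟧ → C⟦X⟧} (hP : Causal P) (hQ : Causal Q) :
    Causal (fun Y => P Y - Q Y) := fun n Y Z h => by
  have := dvd_sub (hP n Y Z h) (hQ n Y Z h)
  convert this using 1
  ring

theorem comp {E : Type*} [CommRing E] {P : C⟦X⟧ → E⟦X⟧} {Q : B⟦X⟧ → C⟦X⟧}
    (hP : Causal P) (hQ : Causal Q) : Causal (fun Y => P (Q Y)) :=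
  fun n Y Z h => hP n _ _ (hQ n Y Z h)

end Causal

variable {B : Type*} [CommRing B] [Algebra ℝ B]

theorem algebraMap_half_mul_two : algebraMap ℝ B⟦X⟧ (1 / 2) * 2 = 1 := by
  rw [← map_ofNat (algebraMap ℝ B⟦X⟧) 2, ← map_mul]
  norm_num

/-- On the series with constant coefficient `1`, the operator `Y ↦ X · Q(Y) - (Y - 1)²` with `Q`
causal is contracting for the `X`-adic metric. -/
theorem Causal.contracting {B : Type*} [CommRing B] {Q : B⟦X⟧ → B⟦X⟧} (hQ : Causal Q) {n : ℕ}
    {Y Z : B⟦X⟧} (hY : constantCoeff Y = 1) (hZ : constantCoeff Z = 1)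
    (h : (X : B⟦X⟧) ^ n ∣ Y - Z) :
    (X : B⟦X⟧) ^ (n + 1) ∣ (X * Q Y - (Y - 1) ^ 2) - (X * Q Z - (Z - 1) ^ 2) := by
  have h1 : (X : B⟦X⟧) ∣ (Y - 1) + (Z - 1) := by
    rw [X_dvd_iff]
    simp [hY, hZ]
  have h2 : (X : B⟦X⟧) ^ (n + 1) ∣ X * (Q Y - Q Z) := by
    rw [pow_succ']
    exact mul_dvd_mul_left _ (hQ n Y Z h)
  have h3 : (X : B⟦X⟧) ^ (n + 1) ∣ (Y - Z) * ((Y - 1) + (Z - 1)) := by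
    rw [pow_succ]
    exact mul_dvd_mul h h1
  have := dvd_sub h2 h3
  convert this using 1
  ring

/-- The equation `Y² = 1 + X · Q(Y)` with `Q` causal determines the coefficients of `Y`
recursively, once `Y` is normalized by `Y(0) = 1`. -/
theorem sq_eq_unique {Q : B⟦X⟧ → B⟦X⟧} (hQ : Causal Q) {Y Z : B⟦X⟧}
    (hY : constantCoeff Y = 1) (hY2 : Y ^ 2 = 1 + X * Q Y)
    (hZ : constantCoeff Z = 1) (hZ2 : Z ^ 2 = 1 + X * Q Z) : Y = Z := by
  refine eq_of_forall_X_pow_dvd_sub fun n => ?_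
  induction n with
  | zero => simp
  | succ n ih =>
    have h : Y - Z = algebraMap ℝ B⟦X⟧ (1 / 2) *
        ((X * Q Y - (Y - 1) ^ 2) - (X * Q Z - (Z - 1) ^ 2)) := by
      linear_combination (Z - Y) * algebraMap_half_mul_two (B := B) +
        algebraMap ℝ B⟦X⟧ (1 / 2) * (hY2 - hZ2)
    rw [h]
    exact (hQ.contracting hY hZ ih).mul_left _

theorem exists_sq_eq {Q : B⟦X⟧ → B⟦X⟧} (hQ : Causal Q) :
    ∃ Y : B⟦X⟧, constantCoeff Y = 1 ∧ Y ^ 2 = 1 + X * Q Y := by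
  -- The solutions are the fixed points of the contracting operator `T`.
  set T : B⟦X⟧ → B⟦X⟧ := fun Y => 1 + algebraMap ℝ B⟦X⟧ (1 / 2) * (X * Q Y - (Y - 1) ^ 2) with hT
  have hT1 : ∀ Y, constantCoeff Y = 1 → constantCoeff (T Y) = 1 := by
    intro Y hY
    simp [hT, hY]
  have hTc : ∀ n Y Z, constantCoeff Y = 1 → constantCoeff Z = 1 → (X : B⟦X⟧) ^ n ∣ Y - Z →
      (X : B⟦X⟧) ^ (n + 1) ∣ T Y - T Z := by
    intro n Y Z hY hZ h
    rw [hT]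
    simp only [add_sub_add_left_eq_sub, ← mul_sub]
    exact (hQ.contracting hY hZ h).mul_left _
  set s : ℕ → B⟦X⟧ := fun n => T^[n] 1 with hs
  have hs1 : ∀ n, s (n + 1) = T (s n) := fun n => Function.iterate_succ_apply' T n 1
  have hsc : ∀ n, constantCoeff (s n) = 1 := by
    intro n
    induction n with
    | zero => simp [hs]
    | succ n ih => rw [hs1]; exact hT1 _ ih
  have hstep : ∀ n, (X : B⟦X⟧) ^ n ∣ s (n + 1) - s n := by
    intro n
    induction n with
    | zero => simp
    | succ n ih =>
      rw [hs1 (n + 1), hs1 n]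
      rw [hs1 n] at ih
      exact hTc n _ _ (hT1 _ (hsc n)) (hsc n) ih
  have hcauchy : ∀ j n, j ≤ n → (X : B⟦X⟧) ^ j ∣ s n - s j := by
    intro j n hjn
    induction n, hjn using Nat.le_induction with
    | base => simp
    | succ n hn ih =>
      have := dvd_add ((pow_dvd_pow (X : B⟦X⟧) hn).trans (hstep n)) ih
      rwa [sub_add_sub_cancel] at this
  set Y : B⟦X⟧ := PowerSeries.mk fun n => coeff n (s (n + 1)) with hY
  have hYs : ∀ n, (X : B⟦X⟧) ^ n ∣ Y - s n := by
    intro n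
    rw [X_pow_dvd_sub_iff]
    intro k hk
    rw [hY, coeff_mk]
    exact (X_pow_dvd_sub_iff.1 (hcauchy (k + 1) n hk) k k.lt_succ_self).symm
  have hYc : constantCoeff Y = 1 := by
    rw [← coeff_zero_eq_constantCoeff_apply, hY, coeff_mk, coeff_zero_eq_constantCoeff_apply, hsc]
  have hfix : T Y = Y := by
    refine eq_of_forall_X_pow_dvd_sub fun n => ?_
    have h1 := hTc n Y (s n) hYc (hsc n) (hYs n)
    rw [← hs1] at h1
    have := dvd_sub h1 (hYs (n + 1))
    rw [sub_sub_sub_cancel_right] at this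
    exact (pow_dvd_pow _ n.le_succ).trans this
  refine ⟨Y, hYc, ?_⟩
  simp only [hT] at hfix
  linear_combination (-2) * hfix + (X * Q Y - (Y - 1) ^ 2) * algebraMap_half_mul_two (B := B)

/-! ### Total derivatives of differential polynomials -/

theorem coeffMap_mul {B : Type*} [CommRing B] [Algebra ℝ B] (D : Derivation ℝ B B) (Y Z : B⟦X⟧) :
    coeffMap D (Y * Z) = Y * coeffMap D Z + Z * coeffMap D Y := by
  ext n
  simp only [coeff_coeffMap, coeff_mul, map_add, map_sum, Derivation.leibniz, smul_eq_mul,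
    Finset.sum_add_distrib]
  congr 1
  rw [← Finset.Nat.sum_antidiagonal_swap]
  rfl

theorem coeffMap_add {B : Type*} [CommRing B] [Algebra ℝ B] (D : Derivation ℝ B B) (Y Z : B⟦X⟧) :
    coeffMap D (Y + Z) = coeffMap D Y + coeffMap D Z := by
  ext n
  simp

theorem coeffMap_C {B : Type*} [CommRing B] [Algebra ℝ B] (D : Derivation ℝ B B) (b : B) :
    coeffMap D (C b) = C (D b) := by
  ext n
  by_cases hn : n = 0 <;> simp [coeff_C, hn]

theorem totalDeriv_X (i : ℕ) :
    totalDeriv (MvPolynomial.X i) = MvPolynomial.X (i + 1) :=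
  MvPolynomial.mkDerivation_X _ _ _

theorem constantCoeff_totalDeriv (P : DiffPoly) :
    MvPolynomial.constantCoeff (totalDeriv P) = 0 := by
  induction P using MvPolynomial.induction_on with
  | C a => simp [totalDeriv]
  | add p q hp hq => simp [hp, hq]
  | mul_X p i hp => simp [hp, totalDeriv_X]

theorem pderiv_succ_totalDeriv (k : ℕ) (P : DiffPoly) :
    MvPolynomial.pderiv (k + 1) (totalDeriv P) =
      totalDeriv (MvPolynomial.pderiv (k + 1) P) + MvPolynomial.pderiv k P := by
  induction P using MvPolynomial.induction_on with
  | C a => simp [totalDeriv]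
  | add p q hp hq =>
    simp only [map_add, hp, hq]
    ring
  | mul_X p i hp =>
    have h : MvPolynomial.pderiv (k + 1) (MvPolynomial.X (i + 1) : DiffPoly) =
        MvPolynomial.pderiv k (MvPolynomial.X i) := by
      simp [MvPolynomial.pderiv_X, Pi.single_apply]
    have h' : totalDeriv (MvPolynomial.pderiv (k + 1) (MvPolynomial.X i : DiffPoly)) = 0 := by
      by_cases hi : i = k + 1 <;> simp [MvPolynomial.pderiv_X, hi]
    simp only [Derivation.leibniz, map_add, smul_eq_mul, hp, totalDeriv_X, h, h']
    ring

/-- In characteristic zero a differential polynomial with vanishing total derivative is a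
constant: by the commutator `[∂/∂u_{k+1}, ∂_x] = ∂/∂u_k`, all its partial derivatives vanish,
starting from those with respect to jets of high order. -/
theorem eq_C_of_totalDeriv_eq_zero {P : DiffPoly} (h : totalDeriv P = 0) :
    P = MvPolynomial.C (MvPolynomial.constantCoeff P) := by
  have hstep : ∀ k, MvPolynomial.pderiv (k + 1) P = 0 → MvPolynomial.pderiv k P = 0 := by
    intro k hk
    have := pderiv_succ_totalDeriv k P
    rw [h, hk] at this
    simpa using this.symm
  have hall : ∀ k, MvPolynomial.pderiv k P = 0 := by
    intro k
    have hbig : ∃ N, k ≤ N ∧ MvPolynomial.pderiv N P = 0 := by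
      refine ⟨k + (P.vars.sup _root_.id + 1), by omega,
        MvPolynomial.pderiv_eq_zero_of_notMem_vars fun hm => ?_⟩
      have := Finset.le_sup (f := _root_.id) hm
      simp only [id_eq] at this
      omega
    obtain ⟨N, hkN, hN⟩ := hbig
    induction N, hkN using Nat.le_induction with
    | base => exact hN
    | succ n _ ih => exact ih (hstep n hN)
  ext d
  rw [MvPolynomial.coeff_C]
  split_ifs with hd
  · rw [← hd]; rfl
  · obtain ⟨i, hi⟩ : ∃ i, d i ≠ 0 := by
      by_contra! hc
      exact hd (Finsupp.ext fun i => (hc i).symm)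
    have hc := congrArg (MvPolynomial.coeff (d - Finsupp.single i 1)) (hall i)
    rw [MvPolynomial.coeff_pderiv, MvPolynomial.coeff_zero] at hc
    rw [tsub_add_cancel_of_le (Finsupp.single_le_iff.2 (Nat.one_le_iff_ne_zero.2 hi))] at hc
    exact (mul_eq_zero.1 hc).resolve_right (by positivity)

/-! ### The Gel'fand–Dikii polynomials -/

/-- The quadratic operator of the resolvent equation
`Y² = 1 + w (rc (2 Y Y'' - Y'²) + 4 u Y²)`. -/
def gelfandDikiiOperator (rc : ℝ) (D : Derivation ℝ B B) (u : B) (Y : B⟦X⟧) : B⟦X⟧ :=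
  C (algebraMap ℝ B rc) *
      (2 * Y * coeffMap D (coeffMap D Y) - coeffMap D Y * coeffMap D Y) +
    4 * C u * (Y * Y)

theorem causal_gelfandDikiiOperator (rc : ℝ) (D : Derivation ℝ B B) (u : B) :
    Causal (gelfandDikiiOperator rc D u) := by
  have hD := Causal.coeffMap (B := B) D
  exact ((Causal.const _).mul ((((Causal.const _).mul .id).mul (hD.comp hD)).sub (hD.mul hD))).add
    ((Causal.const _).mul (Causal.id.mul .id))

/-- Differentiating the quadratic resolvent equation gives the linear one. -/
theorem coeffMap_eq_of_sq_eq [IsDomain B] (rc : ℝ) (D : Derivation ℝ B B) (u : B) {Y : B⟦X⟧}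
    (h1 : constantCoeff Y = 1) (h2 : Y ^ 2 = 1 + X * gelfandDikiiOperator rc D u Y) :
    coeffMap D Y = X * (C (algebraMap ℝ B rc) * coeffMap D (coeffMap D (coeffMap D Y)) +
      4 * C u * coeffMap D Y + 2 * C (D u) * Y) := by
  have hX : coeffMap D (X : B⟦X⟧) = 0 := by
    ext n
    by_cases hn : n = 1 <;> simp [coeff_X, hn]
  have hsub : ∀ Y Z : B⟦X⟧, coeffMap D (Y - Z) = coeffMap D Y - coeffMap D Z := by
    intro Y Z
    ext n
    simp
  have hrc : coeffMap D (C (algebraMap ℝ B rc)) = 0 := by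
    rw [coeffMap_C, Derivation.map_algebraMap, map_zero]
  have hone : coeffMap D (1 : B⟦X⟧) = 0 := by
    rw [← map_one C, coeffMap_C, Derivation.map_one_eq_zero, map_zero]
  have htwo : coeffMap D (2 : B⟦X⟧) = 0 := by
    rw [← one_add_one_eq_two, coeffMap_add, hone, add_zero]
  have hfour : coeffMap D (4 : B⟦X⟧) = 0 := by
    rw [show (4 : B⟦X⟧) = 2 + 2 by norm_num, coeffMap_add, htwo, add_zero]
  have h := congrArg (coeffMap D) h2
  rw [gelfandDikiiOperator, pow_two] at h
  simp only [coeffMap_mul, coeffMap_add, hsub, hX, hrc, hone, htwo, hfour, coeffMap_C] at h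
  have hY0 : Y ≠ 0 := by
    rintro rfl
    simp at h1
  have h20 : (2 : B⟦X⟧) ≠ 0 := by
    rw [← map_ofNat (algebraMap ℝ B⟦X⟧) 2, Ne, map_eq_zero_iff _ (algebraMap ℝ B⟦X⟧).injective]
    norm_num
  refine mul_left_cancel₀ (mul_ne_zero h20 hY0) ?_
  linear_combination h

/-- The coefficients of the normalized resolvent are a Gel'fand–Dikii sequence. -/
theorem isGelfandDikii_coeff (rc : ℝ) {Y : DiffPoly⟦X⟧} (h1 : constantCoeff Y = 1)
    (h2 : Y ^ 2 = 1 + X * gelfandDikiiOperator rc totalDeriv (MvPolynomial.X 0) Y) :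
    IsGelfandDikii rc fun n => coeff n Y := by
  refine ⟨by simpa using h1, fun n => ?_, fun n => ?_⟩
  · have h := congrArg (coeff (n + 1))
      (coeffMap_eq_of_sq_eq rc totalDeriv (MvPolynomial.X 0) h1 h2)
    have h4 : ∀ (P : DiffPoly) (Z : DiffPoly⟦X⟧), coeff n (4 * C P * Z) = 4 * P * coeff n Z := by
      intro P Z
      rw [← map_ofNat (C (R := DiffPoly)) 4, ← map_mul, coeff_C_mul]
    have h2 : ∀ (P : DiffPoly) (Z : DiffPoly⟦X⟧), coeff n (2 * C P * Z) = 2 * P * coeff n Z := by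
      intro P Z
      rw [← map_ofNat (C (R := DiffPoly)) 2, ← map_mul, coeff_C_mul]
    rw [coeff_succ_X_mul] at h
    simpa only [map_add, coeff_C_mul, h4, h2, coeff_coeffMap, totalDeriv_X, Algebra.smul_def]
      using h
  · -- At `u = 0` the resolvent equation reads `c² = 1`, so that `c = 1`.
    have hc : PowerSeries.map (MvPolynomial.constantCoeff (R := ℝ) (σ := ℕ)) Y = 1 := by
      have hQ : PowerSeries.map (MvPolynomial.constantCoeff (R := ℝ) (σ := ℕ))
          (gelfandDikiiOperator rc totalDeriv (MvPolynomial.X 0) Y) = 0 := by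
        have hD : ∀ Z : DiffPoly⟦X⟧, PowerSeries.map
            (MvPolynomial.constantCoeff (R := ℝ) (σ := ℕ)) (coeffMap totalDeriv Z) = 0 := by
          intro Z
          ext n
          simp [constantCoeff_totalDeriv]
        simp [gelfandDikiiOperator, hD]
      refine sq_eq_unique (Causal.const 0) ?_ ?_ (by simp) (by simp)
      · rw [← coeff_zero_eq_constantCoeff_apply, PowerSeries.coeff_map,
          coeff_zero_eq_constantCoeff_apply, h1, map_one]
      · rw [← map_pow, h2, map_add, map_mul, hQ]
        simp
    have := congrArg (coeff (n + 1)) hc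
    simpa [coeff_one] using this

theorem IsGelfandDikii.unique {rc : ℝ} {R S : ℕ → DiffPoly} (hR : IsGelfandDikii rc R)
    (hS : IsGelfandDikii rc S) : R = S := by
  funext n
  induction n with
  | zero => rw [hR.zero, hS.zero]
  | succ n ih =>
    have h : totalDeriv (R (n + 1) - S (n + 1)) = 0 := by
      rw [map_sub, hR.succ, hS.succ, ih, sub_self]
    have := eq_C_of_totalDeriv_eq_zero h
    rw [map_sub, hR.normalized, hS.normalized, sub_zero, map_zero] at this
    exact sub_eq_zero.1 this

/-! ### The diagonal resolvent of a lattice Lax operator -/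

section Lattice

variable {B : Type*} [CommRing B]

/-- The coefficient of `v_m` in `L^j v_n`, for the operator `L v_i = v_{i+1} + r_i v_{i-1}` with
arbitrary coefficients `r` in a commutative ring: the sum over the paths of length `j` from `n` to
`m` of the products of the weights `r_i` of the downward steps `i → i - 1`. -/
def laxEntry (r : ℤ → B) : ℕ → ℤ → ℤ → B
  | 0, n, m => if n = m then 1 else 0
  | j + 1, n, m => laxEntry r j (n + 1) m + r n * laxEntry r j (n - 1) m

theorem laxEntry_zero (r : ℤ → B) (n m : ℤ) : laxEntry r 0 n m = if n = m then 1 else 0 := rfl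

/-- Splitting off the first step of a path. -/
theorem laxEntry_succ (r : ℤ → B) (j : ℕ) (n m : ℤ) :
    laxEntry r (j + 1) n m = laxEntry r j (n + 1) m + r n * laxEntry r j (n - 1) m := rfl

/-- Splitting off the last step of a path. -/
theorem laxEntry_succ' (r : ℤ → B) (j : ℕ) (n m : ℤ) :
    laxEntry r (j + 1) n m = laxEntry r j n (m - 1) + r (m + 1) * laxEntry r j n (m + 1) := by
  induction j generalizing n m with
  | zero =>
    simp only [laxEntry_succ, laxEntry_zero]
    have h1 : n + 1 = m ↔ n = m - 1 := by omega
    have h2 : n - 1 = m ↔ n = m + 1 := by omega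
    simp only [h1, h2]
    split_ifs with h3 h4 <;> simp_all
  | succ j ih =>
    rw [laxEntry_succ, ih, ih, laxEntry_succ r j n (m - 1), laxEntry_succ r j n (m + 1)]
    ring

theorem map_laxEntry {C : Type*} [CommRing C] (f : B →+* C) (r : ℤ → B) (j : ℕ) (n m : ℤ) :
    f (laxEntry r j n m) = laxEntry (fun i => f (r i)) j n m := by
  induction j generalizing n m with
  | zero => simp only [laxEntry_zero]; split_ifs <;> simp
  | succ j ih => simp [laxEntry_succ, ih]

theorem laxEntry_shift (r : ℤ → B) (a : ℤ) (j : ℕ) (n m : ℤ) :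
    laxEntry (fun i => r (i + a)) j n m = laxEntry r j (n + a) (m + a) := by
  induction j generalizing n m with
  | zero => simp [laxEntry_zero]
  | succ j ih =>
    rw [laxEntry_succ, laxEntry_succ, ih, ih, show n + 1 + a = n + a + 1 by ring,
      show n - 1 + a = n + a - 1 by ring]

theorem laxEntry_congr {r s : ℤ → B} {j : ℕ} {n : ℤ} (m : ℤ)
    (h : ∀ i, |i - n| ≤ j → r i = s i) : laxEntry r j n m = laxEntry s j n m := by
  induction j generalizing n with
  | zero => rfl
  | succ j ih =>
    rw [laxEntry_succ, laxEntry_succ, h n (by simp; positivity), ih, ih]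
    all_goals
      intro i hi
      apply h
      rw [abs_le] at hi ⊢
      push_cast
      omega

/-- Reversing paths: compared with a path from `n` to `n + d`, the reversed path carries the extra
weights `r_{n+1}, …, r_{n+d}`. -/
theorem laxEntry_reverse (r : ℤ → B) (j : ℕ) (n : ℤ) (d : ℕ) :
    laxEntry r j (n + d) n =
      (∏ i ∈ Finset.range d, r (n + 1 + i)) * laxEntry r j n (n + d) := by
  induction j generalizing n d with
  | zero =>
    rcases Nat.eq_zero_or_pos d with rfl | hd
    · simp
    · rw [laxEntry_zero, laxEntry_zero, if_neg (by omega), if_neg (by omega), mul_zero]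
  | succ j ih =>
    rcases d with _ | d
    · simp
    · have h1 := ih n (d + 2)
      have h2 := ih n d
      rw [laxEntry_succ, laxEntry_succ' r j n]
      rw [show n + ((d + 1 : ℕ) : ℤ) + 1 = n + ((d + 2 : ℕ) : ℤ) by push_cast; ring,
        show n + ((d + 1 : ℕ) : ℤ) - 1 = n + (d : ℤ) by push_cast; ring, h1, h2,
        Finset.prod_range_succ, Finset.prod_range_succ]
      rw [show n + 1 + ((d + 1 : ℕ) : ℤ) = n + ((d + 2 : ℕ) : ℤ) by push_cast; ring,
        show n + 1 + (d : ℤ) = n + ((d + 1 : ℕ) : ℤ) by push_cast; ring]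
      ring

/-- The series `U_n = 1 + 2 ∑_{k ≥ 1} (L^{2k-1})_{n,n-1} y^k`, where `y = λ⁻¹`. -/
def diagonalResolvent (r : ℤ → B) (n : ℤ) : B⟦X⟧ :=
  PowerSeries.mk fun k => if k = 0 then 1 else 2 * laxEntry r (2 * k - 1) n (n - 1)

theorem constantCoeff_diagonalResolvent (r : ℤ → B) (n : ℤ) :
    constantCoeff (diagonalResolvent r n) = 1 := by
  rw [← coeff_zero_eq_constantCoeff_apply, diagonalResolvent, coeff_mk, if_pos rfl]

theorem coeff_succ_diagonalResolvent (r : ℤ → B) (n : ℤ) (k : ℕ) :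
    coeff (k + 1) (diagonalResolvent r n) = 2 * laxEntry r (2 * k + 1) n (n - 1) := by
  rw [diagonalResolvent, coeff_mk, if_neg k.succ_ne_zero]
  rfl

theorem coeff_diagonalResolvent_add (r : ℤ → B) (n : ℤ) (k : ℕ) :
    coeff k (diagonalResolvent r n + diagonalResolvent r (n + 1)) =
      2 * laxEntry r (2 * k) n n := by
  rcases k with _ | k
  · simp [constantCoeff_diagonalResolvent, laxEntry_zero]
    norm_num
  · have h := laxEntry_reverse r (2 * k + 1) (n - 1) 1
    simp only [Finset.prod_range_one, Nat.cast_one, sub_add_cancel, Nat.cast_zero, add_zero] at h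
    rw [map_add, coeff_succ_diagonalResolvent, coeff_succ_diagonalResolvent,
      show 2 * (k + 1) = 2 * k + 1 + 1 by ring, laxEntry_succ r (2 * k + 1) n n, h,
      add_sub_cancel_right]
    ring

/-- The linear lattice equation, obtained by comparing `L^{2k} L` with `L L^{2k}`. -/
theorem diagonalResolvent_succ_sub (r : ℤ → B) (n : ℤ) :
    diagonalResolvent r (n + 1) - diagonalResolvent r n =
      X * (C (r (n + 1)) * (diagonalResolvent r (n + 1) + diagonalResolvent r (n + 1 + 1)) -
        C (r n) * (diagonalResolvent r (n - 1) + diagonalResolvent r n)) := by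
  ext k
  rcases k with _ | k
  · simp [constantCoeff_diagonalResolvent]
  · have h := coeff_diagonalResolvent_add r (n - 1) k
    rw [sub_add_cancel] at h
    rw [map_sub, coeff_succ_diagonalResolvent, coeff_succ_diagonalResolvent, coeff_succ_X_mul,
      map_sub, coeff_C_mul, coeff_C_mul, coeff_diagonalResolvent_add, h,
      laxEntry_succ' r (2 * k) (n + 1), laxEntry_succ r (2 * k) n]
    rw [show n + 1 - 1 + 1 = n + 1 by ring, show n + 1 - 1 - 1 = n - 1 by ring]
    ring

/-- The deviation of `U` from the quadratic lattice equation. -/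
def resolventDefect (r : ℤ → B) (n : ℤ) : B⟦X⟧ :=
  diagonalResolvent r n ^ 2 - 1 - X * C (r n) *
    ((diagonalResolvent r n + diagonalResolvent r (n + 1)) *
      (diagonalResolvent r n + diagonalResolvent r (n - 1)))

/-- The linear lattice equation times `U_{n+1} + U_n` telescopes. -/
theorem resolventDefect_succ (r : ℤ → B) (n : ℤ) :
    resolventDefect r (n + 1) = resolventDefect r n := by
  have h := diagonalResolvent_succ_sub r n
  rw [resolventDefect, resolventDefect, add_sub_cancel_right]
  linear_combination (diagonalResolvent r (n + 1) + diagonalResolvent r n) * h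

theorem resolventDefect_add (r : ℤ → B) (n : ℤ) (k : ℕ) :
    resolventDefect r (n + k) = resolventDefect r n := by
  induction k with
  | zero => simp
  | succ k ih => rw [← ih, ← resolventDefect_succ r (n + k)]; push_cast; ring_nf

theorem X_pow_dvd_diagonalResolvent_sub {r s : ℤ → B} {n : ℤ} {N : ℕ}
    (h : ∀ i, |i - n| ≤ 2 * N → r i = s i) :
    (X : B⟦X⟧) ^ N ∣ diagonalResolvent r n - diagonalResolvent s n := by
  rw [X_pow_dvd_sub_iff]
  intro k hk
  rcases k with _ | k
  · simp [constantCoeff_diagonalResolvent]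
  · rw [coeff_succ_diagonalResolvent, coeff_succ_diagonalResolvent]
    congr 1
    refine laxEntry_congr _ fun i hi => h i (hi.trans ?_)
    push_cast
    omega

theorem X_pow_dvd_resolventDefect_sub {r s : ℤ → B} {n : ℤ} {N : ℕ}
    (h : ∀ i, |i - n| ≤ 2 * N + 1 → r i = s i) :
    (X : B⟦X⟧) ^ N ∣ resolventDefect r n - resolventDefect s n := by
  have hU : ∀ a : ℤ, |a| ≤ 1 →
      (X : B⟦X⟧) ^ N ∣ diagonalResolvent r (n + a) - diagonalResolvent s (n + a) := by
    intro a ha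
    refine X_pow_dvd_diagonalResolvent_sub fun i hi => h i ?_
    rw [abs_le] at *
    omega
  obtain ⟨c0, h0⟩ := hU 0 (by simp)
  obtain ⟨c1, h1⟩ := hU 1 (by simp)
  obtain ⟨c2, h2⟩ := hU (-1) (by simp)
  rw [add_zero] at h0
  rw [← sub_eq_add_neg] at h2
  rw [resolventDefect, resolventDefect, h n (by simp; positivity)]
  refine ⟨c0 * (diagonalResolvent r n + diagonalResolvent s n) - X * C (s n) *
    ((c0 + c1) * (diagonalResolvent r n + diagonalResolvent r (n - 1)) +
      (diagonalResolvent s n + diagonalResolvent s (n + 1)) * (c0 + c2)), ?_⟩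
  linear_combination (diagonalResolvent r n + diagonalResolvent s n) * h0 - X * C (s n) *
    ((diagonalResolvent r n + diagonalResolvent r (n - 1)) * (h0 + h1) +
      (diagonalResolvent s n + diagonalResolvent s (n + 1)) * (h0 + h2))

theorem laxEntry_zero_weights (j : ℕ) (n m : ℤ) :
    laxEntry (fun _ => (0 : B)) j n m = if n + j = m then 1 else 0 := by
  induction j generalizing n with
  | zero => simp [laxEntry_zero]
  | succ j ih =>
    rw [laxEntry_succ, ih, zero_mul, add_zero]
    push_cast
    ring_nf

theorem resolventDefect_zero_weights (n : ℤ) : resolventDefect (fun _ => (0 : B)) n = 0 := by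
  have h : ∀ n, diagonalResolvent (fun _ => (0 : B)) n = 1 := by
    intro n
    ext k
    rw [diagonalResolvent, coeff_mk, coeff_one, laxEntry_zero_weights]
    split_ifs with h1 h2
    · rfl
    · omega
    · simp
  simp [resolventDefect, h]

/-- The quadratic lattice equation. Its defect does not depend on the site, and modulo any power
of `y` it depends on finitely many of the weights only; cutting the weights off far away from a
site shows that the defect there is that of the zero weights. -/
theorem diagonalResolvent_sq (r : ℤ → B) (n : ℤ) :
    diagonalResolvent r n ^ 2 = 1 + X * (C (r n) *
      ((diagonalResolvent r n + diagonalResolvent r (n + 1)) *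
        (diagonalResolvent r n + diagonalResolvent r (n - 1)))) := by
  suffices h : resolventDefect r n = 0 by
    rw [resolventDefect] at h
    linear_combination h
  refine eq_of_forall_X_pow_dvd_sub fun N => ?_
  set s : ℤ → B := fun i => if i ≤ n + (2 * N + 1) then r i else 0 with hs
  have h1 : (X : B⟦X⟧) ^ N ∣ resolventDefect r n - resolventDefect s n := by
    refine X_pow_dvd_resolventDefect_sub fun i hi => ?_
    rw [abs_le] at hi
    rw [hs]
    simp only
    rw [if_pos (by omega)]
  have h2 : (X : B⟦X⟧) ^ N ∣ resolventDefect s (n + (4 * N + 3 : ℕ)) -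
      resolventDefect (fun _ => (0 : B)) (n + (4 * N + 3 : ℕ)) := by
    refine X_pow_dvd_resolventDefect_sub fun i hi => ?_
    rw [abs_le] at hi
    rw [hs]
    simp only
    rw [if_neg (by push_cast at hi; omega)]
  rw [resolventDefect_add, resolventDefect_zero_weights] at h2
  have := dvd_add h1 h2
  rwa [sub_add_sub_cancel] at this

theorem map_diagonalResolvent {C : Type*} [CommRing C] (f : B →+* C) (r : ℤ → B) (n : ℤ) :
    PowerSeries.map f (diagonalResolvent r n) = diagonalResolvent (fun i => f (r i)) n := by
  ext k
  rw [PowerSeries.coeff_map, diagonalResolvent, diagonalResolvent, coeff_mk, coeff_mk]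
  split_ifs <;> simp [map_laxEntry, map_ofNat]

theorem diagonalResolvent_shift (r : ℤ → B) (a n : ℤ) :
    diagonalResolvent (fun i => r (i + a)) n = diagonalResolvent r (n + a) := by
  ext k
  rw [diagonalResolvent, diagonalResolvent, coeff_mk, coeff_mk, laxEntry_shift]
  congr 3
  ring

end Lattice

theorem laxOperator_pow_apply (r : ScaledSeries) (j : ℕ) (n m : ℤ) :
    ((laxOperator r ^ j) (Finsupp.single n 1)) m = laxEntry (fun i => shift i r) j n m := by
  induction j generalizing n with
  | zero => simp [laxEntry_zero, Finsupp.single_apply]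
  | succ j ih =>
    have h : laxOperator r (Finsupp.single n 1) =
        Finsupp.single (n + 1) 1 + shift n r • Finsupp.single (n - 1) 1 := by
      rw [laxOperator, Finsupp.linearCombination_single, one_smul]
    rw [pow_succ, Module.End.mul_apply, h, map_add, map_smul, Finsupp.add_apply,
      Finsupp.smul_apply, ih, ih, laxEntry_succ, smul_eq_mul]

theorem generatingFunction_eq (r : ScaledSeries) :
    generatingFunction r = diagonalResolvent (fun i => shift i r) 0 := by
  rw [generatingFunction, diagonalResolvent]
  simp only [laxOperator_pow_apply]
  rfl

/-! ### Formal translations -/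

section Translation

/-- Additive maps on power series which turn multiplication by `X` into multiplication by a
multiple of `X` are determined by their values on constants. -/
theorem powerSeries_addMonoidHom_ext {R S : Type*} [CommRing R] [CommRing S] {a : S⟦X⟧}
    (ha : (X : S⟦X⟧) ∣ a) {f g : R⟦X⟧ →+ S⟦X⟧} (hf : ∀ F, f (X * F) = a * f F)
    (hg : ∀ F, g (X * F) = a * g F) (hC : ∀ c, f (C c) = g (C c)) : f = g := by
  ext1 F
  refine eq_of_forall_X_pow_dvd_sub fun n => ?_
  induction n generalizing F with
  | zero => simp
  | succ n ih =>
    obtain ⟨c, G, rfl⟩ : ∃ c G, F = C c + X * G :=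
      ⟨constantCoeff F, PowerSeries.mk fun p => coeff (p + 1) F, by
        rw [add_comm]; exact eq_X_mul_shift_add_const F⟩
    rw [map_add, map_add, hC, hf, hg, add_sub_add_left_eq_sub, ← mul_sub, pow_succ']
    exact mul_dvd_mul ha (ih G)

variable {A : Type*} [CommRing A] [Algebra ℝ A] (D : Derivation ℝ A A)

theorem iterate_derivation_mul (n : ℕ) (a b : A) :
    D^[n] (a * b) = ∑ p ∈ Finset.HasAntidiagonal.antidiagonal n,
      n.choose p.1 • (D^[p.1] a * D^[p.2] b) := by
  induction n with
  | zero => simp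
  | succ n ih =>
    rw [Finset.sum_antidiagonal_choose_succ_nsmul
      (M := A) (fun i j => D^[i] a * D^[j] b) n]
    simp only [Function.iterate_succ_apply', ih, map_sum, map_nsmul, Derivation.leibniz,
      smul_eq_mul, smul_add, Finset.sum_add_distrib]
    congr 1
    refine Finset.sum_congr rfl fun p hp => ?_
    rw [mul_comm, Nat.choose_symm_of_eq_add (Finset.HasAntidiagonal.mem_antidiagonal.1 hp).symm]

theorem iterate_derivation_smul (n : ℕ) (c : ℝ) (a : A) : D^[n] (c • a) = c • D^[n] a := by
  induction n with
  | zero => rfl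
  | succ n ih => rw [Function.iterate_succ_apply', Function.iterate_succ_apply', ih, D.map_smul]

/-- The additive map underlying `translate`. -/
def translateAddHom (s : ℝ) : A⟦X⟧ →+ A⟦X⟧ where
  toFun F := PowerSeries.mk fun n => ∑ p ∈ Finset.HasAntidiagonal.antidiagonal n,
    (s ^ p.1 / (p.1 ! : ℕ)) • D^[p.1] (coeff p.2 F)
  map_zero' := by
    ext n
    simp
  map_add' F G := by
    ext n
    simp [Finset.sum_add_distrib]

theorem coeff_translateAddHom (s : ℝ) (F : A⟦X⟧) (n : ℕ) :
    coeff n (translateAddHom D s F) = ∑ p ∈ Finset.HasAntidiagonal.antidiagonal n,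
      (s ^ p.1 / (p.1 ! : ℕ)) • D^[p.1] (coeff p.2 F) := by
  simp [translateAddHom]

theorem translateAddHom_X_mul (s : ℝ) (F : A⟦X⟧) :
    translateAddHom D s (X * F) = X * translateAddHom D s F := by
  ext n
  rcases n with _ | n
  · simp [coeff_translateAddHom]
  · rw [coeff_succ_X_mul, coeff_translateAddHom, coeff_translateAddHom,
      Finset.Nat.sum_antidiagonal_succ']
    simp [coeff_succ_X_mul]

theorem coeff_translateAddHom_C (s : ℝ) (a : A) (n : ℕ) :
    coeff n (translateAddHom D s (C a)) = (s ^ n / (n ! : ℕ)) • D^[n] a := by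
  rw [coeff_translateAddHom, Finset.sum_eq_single (n, 0)]
  · simp
  · rintro ⟨i, j⟩ hij hne
    rw [Finset.HasAntidiagonal.mem_antidiagonal] at hij
    have hj : j ≠ 0 := by
      rintro rfl
      exact hne (by simp at hij; simp [hij])
    simp [coeff_C, hj]
  · simp

theorem translateAddHom_C_mul_C (s : ℝ) (a b : A) :
    translateAddHom D s (C (a * b)) = translateAddHom D s (C a) * translateAddHom D s (C b) := by
  ext n
  rw [coeff_mul, coeff_translateAddHom_C, iterate_derivation_mul, Finset.smul_sum]
  refine Finset.sum_congr rfl fun p hp => ?_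
  rw [coeff_translateAddHom_C, coeff_translateAddHom_C, smul_mul_smul_comm,
    ← Nat.cast_smul_eq_nsmul ℝ, smul_smul]
  congr 1
  rw [← Finset.HasAntidiagonal.mem_antidiagonal.1 hp, Nat.cast_add_choose, pow_add]
  have := Nat.factorial_ne_zero (p.1 + p.2)
  field_simp

theorem translateAddHom_mul (s : ℝ) (F G : A⟦X⟧) :
    translateAddHom D s (F * G) = translateAddHom D s F * translateAddHom D s G := by
  have hC : ∀ (a : A) (G : A⟦X⟧),
      translateAddHom D s (C a * G) = translateAddHom D s (C a) * translateAddHom D s G := by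
    intro a G
    have h := powerSeries_addMonoidHom_ext (dvd_refl (X : A⟦X⟧))
      (f := (translateAddHom D s).comp (AddMonoidHom.mulLeft (C a)))
      (g := (AddMonoidHom.mulLeft (translateAddHom D s (C a))).comp (translateAddHom D s))
      (fun F => by simp [mul_left_comm _ X, translateAddHom_X_mul])
      (fun F => by simp [mul_left_comm _ X, translateAddHom_X_mul])
      (fun c => by
        change translateAddHom D s (C a * C c) =
          translateAddHom D s (C a) * translateAddHom D s (C c)
        rw [← map_mul, translateAddHom_C_mul_C])
    exact DFunLike.congr_fun h G
  have h := powerSeries_addMonoidHom_ext (dvd_refl (X : A⟦X⟧))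
    (f := (translateAddHom D s).comp (AddMonoidHom.mulRight G))
    (g := (AddMonoidHom.mulRight (translateAddHom D s G)).comp (translateAddHom D s))
    (fun F => by simp [mul_assoc, translateAddHom_X_mul])
    (fun F => by simp [mul_assoc, translateAddHom_X_mul])
    (fun c => by simp [hC])
  exact DFunLike.congr_fun h F

theorem translateAddHom_C_algebraMap (s c : ℝ) :
    translateAddHom D s (C (algebraMap ℝ A c)) = C (algebraMap ℝ A c) := by
  ext n
  rw [coeff_translateAddHom_C]
  rcases n with _ | n
  · simp
  · simp [Function.iterate_succ_apply]

/-- The translation `x ↦ x + s ε` on the formal power series in `ε` over a differential algebra: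
the operator `exp (s ε D)`. -/
def translate (s : ℝ) : A⟦X⟧ →+* A⟦X⟧ :=
  { translateAddHom D s with
    map_one' := by
      have := translateAddHom_C_algebraMap D s 1
      rwa [map_one, map_one] at this
    map_mul' := translateAddHom_mul D s }

theorem coeff_translate (s : ℝ) (F : A⟦X⟧) (n : ℕ) :
    coeff n (translate D s F) = ∑ p ∈ Finset.HasAntidiagonal.antidiagonal n,
      (s ^ p.1 / (p.1 ! : ℕ)) • D^[p.1] (coeff p.2 F) :=
  coeff_translateAddHom D s F n

theorem translate_C_algebraMap (s c : ℝ) :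
    translate D s (C (algebraMap ℝ A c)) = C (algebraMap ℝ A c) :=
  translateAddHom_C_algebraMap D s c

theorem translate_X (s : ℝ) : translate D s (X : A⟦X⟧) = X := by
  have h := translateAddHom_X_mul D s 1
  have h1 : translateAddHom D s 1 = 1 := map_one (translate D s)
  rw [mul_one, h1, mul_one] at h
  exact h

theorem translate_translate (s t : ℝ) (F : A⟦X⟧) :
    translate D s (translate D t F) = translate D (s + t) F := by
  have h := powerSeries_addMonoidHom_ext (dvd_refl (X : A⟦X⟧))
    (f := (translateAddHom D s).comp (translateAddHom D t)) (g := translateAddHom D (s + t))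
    (fun F => by simp [translateAddHom_X_mul]) (fun F => by simp [translateAddHom_X_mul])
    (fun a => by
      ext n
      rw [AddMonoidHom.comp_apply, coeff_translateAddHom_C, coeff_translateAddHom]
      rw [(Commute.all s t).add_pow', Finset.sum_div, Finset.sum_smul]
      refine Finset.sum_congr rfl fun p hp => ?_
      rw [coeff_translateAddHom_C, iterate_derivation_smul, ← Function.iterate_add_apply,
        Finset.HasAntidiagonal.mem_antidiagonal.1 hp, smul_smul]
      congr 1
      rw [← Finset.HasAntidiagonal.mem_antidiagonal.1 hp, nsmul_eq_mul, Nat.cast_add_choose]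
      have := Nat.factorial_ne_zero (p.1 + p.2)
      field_simp)
  exact DFunLike.congr_fun h F

theorem translate_zero (F : A⟦X⟧) : translate D 0 F = F := by
  ext n
  rw [coeff_translate, Finset.sum_eq_single (0, n)]
  · simp
  · rintro ⟨i, j⟩ hij hne
    rw [Finset.HasAntidiagonal.mem_antidiagonal] at hij
    have hi : i ≠ 0 := by
      rintro rfl
      exact hne (by simp at hij; simp [hij])
    simp [hi]
  · simp

/-- The first difference quotient `(exp (ε D) - 1) / ε`. -/
def firstDifference (F : A⟦X⟧) : A⟦X⟧ :=
  PowerSeries.mk fun n => coeff (n + 1) (translate D 1 F - F)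

/-- The second difference quotient `(exp (ε D) + exp (-ε D) - 2) / ε²`. -/
def secondDifference (F : A⟦X⟧) : A⟦X⟧ :=
  PowerSeries.mk fun n => coeff (n + 2) (translate D 1 F + translate D (-1) F - 2 * F)

theorem translate_one_eq (F : A⟦X⟧) : translate D 1 F = F + X * firstDifference D F := by
  ext n
  rcases n with _ | n
  · simp only [coeff_translate, map_add, coeff_zero_X_mul]
    simp
  · rw [map_add, coeff_succ_X_mul, firstDifference, coeff_mk, map_sub]
    ring

theorem coeff_two_mul {R : Type*} [CommRing R] (F : R⟦X⟧) (n : ℕ) :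
    coeff n (2 * F) = 2 * coeff n F := by
  rw [← map_ofNat (C (R := R)) 2, coeff_C_mul]

theorem translate_neg_one_eq (F : A⟦X⟧) :
    translate D (-1) F = F - X * firstDifference D F + X ^ 2 * secondDifference D F := by
  have h : translate D 1 F + translate D (-1) F - 2 * F = X ^ 2 * secondDifference D F := by
    ext n
    rcases n with _ | _ | n
    · rw [coeff_zero_eq_constantCoeff_apply, coeff_zero_eq_constantCoeff_apply]
      rw [map_sub, map_add, map_mul constantCoeff 2 F]
      simp only [← coeff_zero_eq_constantCoeff_apply, coeff_translate]
      simp [map_ofNat]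
      ring
    · rw [map_sub, map_add, coeff_two_mul, coeff_X_pow_mul', if_neg (by omega), coeff_translate,
        coeff_translate]
      simp [Finset.Nat.sum_antidiagonal_succ]
      ring
    · rw [show n + 1 + 1 = n + 2 by ring, coeff_X_pow_mul, secondDifference, coeff_mk]
  rw [translate_one_eq] at h
  linear_combination h

theorem constantCoeff_translate (s : ℝ) (F : A⟦X⟧) :
    constantCoeff (translate D s F) = constantCoeff F := by
  rw [← coeff_zero_eq_constantCoeff_apply, coeff_translate]
  simp

theorem constantCoeff_firstDifference (F : A⟦X⟧) :
    constantCoeff (firstDifference D F) = D (constantCoeff F) := by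
  rw [← coeff_zero_eq_constantCoeff_apply, firstDifference, coeff_mk, map_sub, coeff_translate,
    Finset.Nat.sum_antidiagonal_succ]
  simp

theorem constantCoeff_secondDifference (F : A⟦X⟧) :
    constantCoeff (secondDifference D F) = D (D (constantCoeff F)) := by
  rw [← coeff_zero_eq_constantCoeff_apply, secondDifference, coeff_mk, map_sub, map_add,
    coeff_two_mul, coeff_translate, coeff_translate]
  simp only [Finset.Nat.sum_antidiagonal_succ, zero_add, Finset.Nat.antidiagonal_zero,
    Finset.sum_singleton]
  have h2 : (2⁻¹ : ℝ) • D (D (constantCoeff F)) + (2⁻¹ : ℝ) • D (D (constantCoeff F)) =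
      D (D (constantCoeff F)) := by
    rw [← add_smul]
    norm_num
  simp
  linear_combination h2

end Translation

/-! ### The resolvent at a constant recurrence coefficient -/

/-- The expansion of `(1 - 4 rc y)^(-1/2) (y / (1 - 4 rc y))^k` in powers of `y`; its coefficients
are the `k`-th derivatives of `binom(2n, n) r^n` at `rc`, divided by `2^k (2k-1)!!`. -/
def binomialSeries (rc : ℝ) (k : ℕ) : ℝ⟦X⟧ :=
  PowerSeries.mk fun n => ((2 * n).choose n : ℝ) * (n.descFactorial k) * rc ^ (n - k) /
    (2 ^ k * ((2 * k - 1)‼ : ℕ))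

theorem coeff_binomialSeries (rc : ℝ) (k n : ℕ) :
    coeff n (binomialSeries rc k) = ((2 * n).choose n : ℝ) * (n.descFactorial k) * rc ^ (n - k) /
      (2 ^ k * ((2 * k - 1)‼ : ℕ)) :=
  coeff_mk n _

theorem constantCoeff_binomialSeries_zero (rc : ℝ) : constantCoeff (binomialSeries rc 0) = 1 := by
  rw [← coeff_zero_eq_constantCoeff_apply, coeff_binomialSeries]
  simp

theorem choose_two_mul_succ (n : ℕ) :
    ((n : ℝ) + 1) * ((2 * (n + 1)).choose (n + 1) : ℝ) =
      2 * (2 * n + 1) * ((2 * n).choose n : ℝ) := by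
  have h := Nat.succ_mul_centralBinom_succ n
  rw [Nat.centralBinom_eq_two_mul_choose, Nat.centralBinom_eq_two_mul_choose] at h
  exact_mod_cast h

theorem doubleFactorial_two_mul_succ_sub_one (k : ℕ) :
    (2 * (k + 1) - 1)‼ = (2 * k + 1) * (2 * k - 1)‼ := by
  rcases k with _ | k
  · simp
  · rw [show 2 * (k + 1 + 1) - 1 = 2 * k + 1 + 2 by omega, Nat.doubleFactorial_add_two,
      show 2 * (k + 1) - 1 = 2 * k + 1 by omega]
    ring

theorem one_sub_mul_binomialSeries_succ (rc : ℝ) (k : ℕ) :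
    (1 - C (4 * rc) * X) * binomialSeries rc (k + 1) = X * binomialSeries rc k := by
  ext n
  rw [sub_mul, one_mul, map_sub, mul_assoc, coeff_C_mul]
  rcases n with _ | n
  · rw [coeff_zero_X_mul, coeff_zero_X_mul, coeff_binomialSeries]
    simp
  rw [coeff_succ_X_mul, coeff_succ_X_mul, coeff_binomialSeries, coeff_binomialSeries,
    coeff_binomialSeries, doubleFactorial_two_mul_succ_sub_one, Nat.succ_descFactorial_succ,
    Nat.descFactorial_succ, Nat.add_sub_add_right]
  have hD : ((2 * k - 1)‼ : ℝ) ≠ 0 := by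
    exact_mod_cast (Nat.doubleFactorial_pos _).ne'
  have hk : (2 * (k : ℝ) + 1) ≠ 0 := by positivity
  have hc := choose_two_mul_succ n
  rcases lt_or_ge n k with h | h
  · rw [Nat.descFactorial_of_lt h]
    simp
  · have hr : ((n - k : ℕ) : ℝ) * (rc * rc ^ (n - (k + 1))) = ((n : ℝ) - k) * rc ^ (n - k) := by
      rcases h.eq_or_lt with rfl | h'
      · simp
      · rw [← pow_succ', show n - (k + 1) + 1 = n - k by omega, Nat.cast_sub h]
    push_cast
    rw [pow_succ]
    field_simp
    linear_combination (n.descFactorial k : ℝ) * rc ^ (n - k) * hc -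
      4 * ((2 * n).choose n : ℝ) * (n.descFactorial k : ℝ) * hr

/-- `U₀² = 1 / (1 - 4 rc y)`, since `U₀` solves `(1 - 4 rc y) U₀' = 2 rc U₀`. -/
theorem binomialSeries_zero_sq (rc : ℝ) :
    binomialSeries rc 0 ^ 2 * (1 - C (4 * rc) * X) = 1 := by
  have hode : (1 - C (4 * rc) * X) * d⁄dX ℝ (binomialSeries rc 0) =
      C (2 * rc) * binomialSeries rc 0 := by
    ext n
    rw [sub_mul, one_mul, map_sub, mul_assoc, coeff_C_mul, coeff_C_mul]
    have hc := choose_two_mul_succ n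
    rcases n with _ | n
    · rw [coeff_zero_X_mul, coeff_derivative, coeff_binomialSeries, coeff_binomialSeries]
      simp
    · rw [coeff_succ_X_mul]
      simp only [coeff_derivative, coeff_binomialSeries]
      simp only [Nat.descFactorial_zero, Nat.sub_zero, Nat.cast_one, mul_one, mul_zero,
        Nat.zero_sub, Nat.doubleFactorial, pow_zero, div_one]
      push_cast at hc ⊢
      linear_combination rc ^ (n + 2) * hc
  refine derivative.ext ?_ ?_
  · rw [Derivation.leibniz, Derivation.leibniz_pow, map_sub, Derivation.map_one_eq_zero,
      Derivation.leibniz, derivative_X, derivative_C]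
    simp only [smul_eq_mul, nsmul_eq_mul, map_mul, map_ofNat] at hode ⊢
    push_cast
    linear_combination (2 * binomialSeries rc 0) * hode
  · rw [map_mul, map_pow, constantCoeff_binomialSeries_zero]
    simp

/-- The expansion of `w = 1 / (λ - 4 rc)` in powers of `y = λ⁻¹`. -/
def criticalVariable (rc : ℝ) : ℝ⟦X⟧ := X * binomialSeries rc 0 ^ 2

theorem criticalVariable_mul (rc : ℝ) : criticalVariable rc * (1 - C (4 * rc) * X) = X := by
  rw [criticalVariable, mul_assoc, binomialSeries_zero_sq, mul_one]

theorem binomialSeries_eq (rc : ℝ) (k : ℕ) :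
    binomialSeries rc k = binomialSeries rc 0 * criticalVariable rc ^ k := by
  induction k with
  | zero => simp
  | succ k ih =>
    have hw : criticalVariable rc = X * binomialSeries rc 0 ^ 2 := rfl
    linear_combination (-binomialSeries rc (k + 1)) * binomialSeries_zero_sq rc +
      binomialSeries rc 0 ^ 2 * one_sub_mul_binomialSeries_succ rc k +
      X * binomialSeries rc 0 ^ 2 * ih - binomialSeries rc 0 * criticalVariable rc ^ k * hw

/-! ### The scaled resolvent equation -/

section Scaled

variable {A : Type*} [CommRing A] [Algebra ℝ A] (D : Derivation ℝ A A)

/-- Translation by `s ε` of the coefficients of a power series in a further variable. -/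
abbrev translateCoeff (s : ℝ) : A⟦X⟧⟦X⟧ →+* A⟦X⟧⟦X⟧ := PowerSeries.map (translate D s)

theorem translateCoeff_one_eq (Y : A⟦X⟧⟦X⟧) :
    translateCoeff D 1 Y = Y + C X * coeffMap (firstDifference D) Y := by
  ext1 n
  simp [translate_one_eq]

theorem translateCoeff_neg_one_eq (Y : A⟦X⟧⟦X⟧) :
    translateCoeff D (-1) Y = Y - C X * coeffMap (firstDifference D) Y +
      C X ^ 2 * coeffMap (secondDifference D) Y := by
  ext1 n
  rw [map_add, map_sub, ← map_pow, coeff_C_mul, coeff_C_mul]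
  simp [translate_neg_one_eq]

/-- The operator `Q` of the scaled resolvent equation `Y² = 1 + w Q(Y)`, for the recurrence
coefficient `r = rc + ε² ρ`. It equals `ε⁻²` times `r (Y + Y₊) (Y + Y₋) - 4 rc Y²`, where `Y₊` and
`Y₋` are the translates of `Y` by `±ε`; in terms of difference quotients, the negative powers of
`ε` cancel. -/
def scaledOperator (rc : ℝ) (ρ : A⟦X⟧) (Y : A⟦X⟧⟦X⟧) : A⟦X⟧⟦X⟧ :=
  C (algebraMap ℝ A⟦X⟧ rc) * (2 * Y * coeffMap (secondDifference D) Y -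
      coeffMap (firstDifference D) Y * coeffMap (firstDifference D) Y +
      C X * (coeffMap (firstDifference D) Y * coeffMap (secondDifference D) Y)) +
    C ρ * ((Y + translateCoeff D 1 Y) * (Y + translateCoeff D (-1) Y))

theorem causal_scaledOperator (rc : ℝ) (ρ : A⟦X⟧) : Causal (scaledOperator D rc ρ) := by
  have h1 := Causal.coeffMap (B := A⟦X⟧) (firstDifference D)
  have h2 := Causal.coeffMap (B := A⟦X⟧) (secondDifference D)
  have hp := Causal.map (translate D 1)
  have hm := Causal.map (translate D (-1))
  exact ((Causal.const _).mul (((((Causal.const _).mul .id).mul h2).sub (h1.mul h1)).add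
    ((Causal.const _).mul (h1.mul h2)))).add
    ((Causal.const _).mul ((Causal.id.add hp).mul (Causal.id.add hm)))

/-- The recurrence coefficient `rc + ε² ρ`. -/
def scaledRecurrence (rc : ℝ) (ρ : A⟦X⟧) : A⟦X⟧ := algebraMap ℝ A⟦X⟧ rc + X ^ 2 * ρ

theorem C_X_sq_mul_scaledOperator (rc : ℝ) (ρ : A⟦X⟧) (Y : A⟦X⟧⟦X⟧) :
    C X ^ 2 * scaledOperator D rc ρ Y = C (scaledRecurrence rc ρ) *
      ((Y + translateCoeff D 1 Y) * (Y + translateCoeff D (-1) Y)) -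
        4 * C (algebraMap ℝ A⟦X⟧ rc) * Y ^ 2 := by
  rw [scaledOperator, scaledRecurrence, map_add, map_mul, map_pow, translateCoeff_one_eq,
    translateCoeff_neg_one_eq]
  ring

/-- At `ε = 0` the scaled resolvent equation becomes the Gel'fand–Dikii resolvent equation. -/
theorem map_constantCoeff_scaledOperator (rc : ℝ) (ρ : A⟦X⟧) (Y : A⟦X⟧⟦X⟧) :
    PowerSeries.map constantCoeff (scaledOperator D rc ρ Y) =
      gelfandDikiiOperator rc D (constantCoeff ρ) (PowerSeries.map constantCoeff Y) := by
  have h1 : PowerSeries.map constantCoeff (coeffMap (firstDifference D) Y) =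
      coeffMap D (PowerSeries.map constantCoeff Y) := by
    ext n
    simp [constantCoeff_firstDifference]
  have h2 : PowerSeries.map constantCoeff (coeffMap (secondDifference D) Y) =
      coeffMap D (coeffMap D (PowerSeries.map constantCoeff Y)) := by
    ext n
    simp [constantCoeff_secondDifference]
  have h3 : ∀ s, PowerSeries.map constantCoeff (translateCoeff D s Y) =
      PowerSeries.map constantCoeff Y := by
    intro s
    ext n
    simp [constantCoeff_translate]
  have hrc : constantCoeff (algebraMap ℝ A⟦X⟧ rc) = algebraMap ℝ A rc := by
    rw [PowerSeries.algebraMap_apply, constantCoeff_C]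
  simp only [scaledOperator, gelfandDikiiOperator, map_add, map_sub, map_mul, map_ofNat, h1, h2,
    h3, PowerSeries.map_C, hrc, constantCoeff_X, map_zero]
  ring

/-- Substitution of a series without constant term, as a ring homomorphism. -/
theorem exists_substitution {R : Type*} [CommRing R] {a : R⟦X⟧} (ha : constantCoeff a = 0) :
    ∃ S : R⟦X⟧ →+* R⟦X⟧, S X = a ∧ ∀ b, S (C b) = C b := by
  have hs : HasSubst a := HasSubst.of_constantCoeff_zero' ha
  refine ⟨(substAlgHom hs : R⟦X⟧ →ₐ[R] R⟦X⟧).toRingHom, ?_, ?_⟩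
  · exact substAlgHom_X hs
  · intro b
    exact (substAlgHom hs : R⟦X⟧ →ₐ[R] R⟦X⟧).commutes b

variable {D}

/-- The generating function `U` is `(1 - 4 rc y)^(-1/2) Y(ε² w)` with `w = y / (1 - 4 rc y)` and
`Y` the solution of the scaled resolvent equation: both sides solve the quadratic lattice
equation, which determines `U` uniquely. -/
theorem diagonalResolvent_eq {rc : ℝ} {ρ : A⟦X⟧} {Y : A⟦X⟧⟦X⟧} (hY1 : constantCoeff Y = 1)
    (hY2 : Y ^ 2 = 1 + X * scaledOperator D rc ρ Y) {S : A⟦X⟧⟦X⟧ →+* A⟦X⟧⟦X⟧}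
    (hSX : S X = C X ^ 2 * PowerSeries.map (algebraMap ℝ A⟦X⟧) (criticalVariable rc))
    (hSC : ∀ b, S (C b) = C b) :
    diagonalResolvent (fun i : ℤ => translate D i (scaledRecurrence rc ρ)) 0 =
      PowerSeries.map (algebraMap ℝ A⟦X⟧) (binomialSeries rc 0) * S Y := by
  set r := scaledRecurrence rc ρ with hr
  set w := PowerSeries.map (algebraMap ℝ A⟦X⟧) (criticalVariable rc) with hw
  set u := PowerSeries.map (algebraMap ℝ A⟦X⟧) (binomialSeries rc 0) with hu
  have halg : ∀ s c : ℝ, translate D s (algebraMap ℝ A⟦X⟧ c) = algebraMap ℝ A⟦X⟧ c := by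
    intro s c
    rw [PowerSeries.algebraMap_apply]
    exact translate_C_algebraMap D s c
  have hreal : ∀ (s : ℝ) (F : ℝ⟦X⟧), translateCoeff D s (PowerSeries.map (algebraMap ℝ A⟦X⟧) F) =
      PowerSeries.map (algebraMap ℝ A⟦X⟧) F := by
    intro s F
    ext1 n
    simp [halg]
  have hSdvd : (X : A⟦X⟧⟦X⟧) ∣ S X := by
    rw [hSX, hw, criticalVariable, map_mul, PowerSeries.map_X]
    exact (dvd_mul_right X _).mul_left _
  have hcomm : ∀ (s : ℝ) (F : A⟦X⟧⟦X⟧), translateCoeff D s (S F) = S (translateCoeff D s F) := by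
    intro s F
    have h := powerSeries_addMonoidHom_ext hSdvd
      (f := ((translateCoeff D s).comp S).toAddMonoidHom)
      (g := (S.comp (translateCoeff D s)).toAddMonoidHom)
      (fun F => by
        change translateCoeff D s (S (X * F)) = S X * translateCoeff D s (S F)
        rw [map_mul, map_mul, hSX, map_mul, map_pow, hreal, PowerSeries.map_C, translate_X])
      (fun F => by
        change S (translateCoeff D s (X * F)) = S X * S (translateCoeff D s F)
        rw [map_mul, map_mul, PowerSeries.map_X])
      (fun c => by
        change translateCoeff D s (S (C c)) = S (translateCoeff D s (C c))
        rw [hSC, PowerSeries.map_C, hSC])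
    exact DFunLike.congr_fun h F
  have hQ : Causal fun U : A⟦X⟧⟦X⟧ =>
      C r * ((U + translateCoeff D 1 U) * (U + translateCoeff D (-1) U)) :=
    (Causal.const _).mul ((Causal.id.add (Causal.map _)).mul (Causal.id.add (Causal.map _)))
  have hsite : ∀ a : ℤ, translateCoeff D a (diagonalResolvent (fun i : ℤ => translate D i r) 0) =
      diagonalResolvent (fun i : ℤ => translate D i r) (0 + a) := by
    intro a
    rw [map_diagonalResolvent, ← diagonalResolvent_shift]
    congr 1
    funext i
    rw [translate_translate]
    push_cast
    rw [add_comm]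
  refine sq_eq_unique hQ (constantCoeff_diagonalResolvent _ _) ?_ ?_ ?_
  · have h := diagonalResolvent_sq (fun i : ℤ => translate D i r) 0
    have hp := hsite 1
    have hm := hsite (-1)
    rw [Int.cast_one] at hp
    rw [Int.cast_neg, Int.cast_one] at hm
    rw [h, hp, hm, Int.cast_zero, translate_zero]
    rfl
  · have h1 : constantCoeff (S Y) = 1 := by
      obtain ⟨Z, hZ⟩ : (X : A⟦X⟧⟦X⟧) ∣ Y - 1 := by
        rw [X_dvd_iff, map_sub, hY1, map_one, sub_self]
      obtain ⟨c, hc⟩ := hSdvd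
      rw [eq_add_of_sub_eq hZ, map_add, map_mul, hc, map_one]
      simp
    have h2 : constantCoeff u = 1 := by
      rw [hu, ← coeff_zero_eq_constantCoeff_apply, PowerSeries.coeff_map,
        coeff_zero_eq_constantCoeff_apply, constantCoeff_binomialSeries_zero, map_one]
    rw [map_mul, h1, h2, one_mul]
  · -- The equation for `Y` gives `s² = 1 + w (r (s + s₊) (s + s₋) - 4 rc s²)` for `s = Y(ε² w)`.
    have hS : S Y ^ 2 = 1 + w * (C r * ((S Y + translateCoeff D 1 (S Y)) *
        (S Y + translateCoeff D (-1) (S Y))) - 4 * C (algebraMap ℝ A⟦X⟧ rc) * S Y ^ 2) := by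
      have h := congrArg S (C_X_sq_mul_scaledOperator D rc ρ Y)
      have hs : S Y ^ 2 = 1 + C X ^ 2 * w * S (scaledOperator D rc ρ Y) := by
        rw [← map_pow, hY2, map_add, map_one, map_mul, hSX]
      simp only [map_sub, map_mul, map_add, map_pow, hSC, map_ofNat, ← hcomm] at h
      linear_combination hs + w * h
    have hw2 := congrArg (PowerSeries.map (algebraMap ℝ A⟦X⟧)) (criticalVariable_mul rc)
    have hu2 := congrArg (PowerSeries.map (algebraMap ℝ A⟦X⟧)) (binomialSeries_zero_sq rc)
    simp only [map_mul, map_sub, map_pow, map_one, PowerSeries.map_X, PowerSeries.map_C,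
      map_ofNat] at hw2 hu2
    rw [← hw] at hw2
    rw [← hu] at hu2
    simp only [map_mul]
    rw [show translateCoeff D 1 u = u from hreal 1 _,
      show translateCoeff D (-1) u = u from hreal (-1) _]
    set c := C (algebraMap ℝ A⟦X⟧ rc) with hc
    set T := C r * ((S Y + translateCoeff D 1 (S Y)) * (S Y + translateCoeff D (-1) (S Y))) with hT
    have hfin : (u * S Y) ^ 2 = 1 + X * (u ^ 2 * T) := by
      linear_combination u ^ 2 * (1 - 4 * c * X) * hS + u ^ 2 * (T - 4 * c * S Y ^ 2) * hw2 + hu2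
    rw [hfin, hT]
    ring

/-- The coefficients of `U`, expanded in the critical resolvents `U₀ w^k`. -/
theorem coeff_coeff_diagonalResolvent {rc : ℝ} {ρ : A⟦X⟧} {Y : A⟦X⟧⟦X⟧}
    (hY1 : constantCoeff Y = 1) (hY2 : Y ^ 2 = 1 + X * scaledOperator D rc ρ Y) (m n : ℕ) :
    coeff (2 * m) (coeff n
        (diagonalResolvent (fun i : ℤ => translate D i (scaledRecurrence rc ρ)) 0)) =
      ∑ k ∈ Finset.range (m + 1),
        coeff n (binomialSeries rc k) • coeff (2 * m - 2 * k) (coeff k Y) := by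
  obtain ⟨S, hSX, hSC⟩ := exists_substitution (R := A⟦X⟧)
    (a := C X ^ 2 * PowerSeries.map (algebraMap ℝ A⟦X⟧) (criticalVariable rc))
    (by simp [criticalVariable])
  rw [diagonalResolvent_eq hY1 hY2 hSX hSC]
  obtain ⟨Z, hZ⟩ : (X : A⟦X⟧⟦X⟧) ^ (m + 1) ∣
      Y - ∑ k ∈ Finset.range (m + 1), C (coeff k Y) * X ^ k := by
    rw [X_pow_dvd_sub_iff]
    intro k hk
    simp [coeff_C_mul, coeff_X_pow, hk]
  rw [sub_eq_iff_eq_add] at hZ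
  have hSY : PowerSeries.map (algebraMap ℝ A⟦X⟧) (binomialSeries rc 0) * S Y =
      C (X ^ (2 * m + 2)) *
        (PowerSeries.map (algebraMap ℝ A⟦X⟧) (binomialSeries rc (m + 1)) * S Z) +
      ∑ k ∈ Finset.range (m + 1), C (X ^ (2 * k) * coeff k Y) *
        PowerSeries.map (algebraMap ℝ A⟦X⟧) (binomialSeries rc k) := by
    conv_lhs => rw [hZ]
    rw [map_add, map_sum, mul_add, Finset.mul_sum, map_mul, map_pow, hSX]
    congr 1
    · rw [binomialSeries_eq rc (m + 1), map_mul, map_pow, map_pow]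
      ring
    · refine Finset.sum_congr rfl fun k _ => ?_
      rw [binomialSeries_eq rc k, map_mul S, map_pow S, hSX, hSC]
      simp only [map_mul, map_pow]
      ring
  rw [hSY, map_add, map_add, coeff_C_mul, coeff_X_pow_mul', if_neg (by omega), zero_add, map_sum,
    map_sum]
  refine Finset.sum_congr rfl fun k hk => ?_
  have hk' : 2 * k ≤ 2 * m := by
    have := Finset.mem_range.1 hk
    omega
  rw [coeff_C_mul, PowerSeries.coeff_map, mul_assoc, coeff_X_pow_mul', if_pos hk',
    mul_comm (coeff k Y), ← Algebra.smul_def]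
  rfl

end Scaled

/-! ### Evaluation on functions and the Painlevé hierarchy -/

/-- The differential algebra generated by the jets `𝔯_k^{(j)}` (the variable `X (k, j)`) of
infinitely many functions. -/
abbrev JetAlgebra : Type := MvPolynomial (ℕ × ℕ) ℝ

/-- The total derivative, which sends `𝔯_k^{(j)}` to `𝔯_k^{(j+1)}`. -/
def jetDeriv : Derivation ℝ JetAlgebra JetAlgebra :=
  MvPolynomial.mkDerivation ℝ fun p => MvPolynomial.X (p.1, p.2 + 1)

theorem iterate_jetDeriv_X (k j i : ℕ) :
    jetDeriv^[i] (MvPolynomial.X (k, j)) = MvPolynomial.X (k, j + i) := by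
  induction i generalizing j with
  | zero => rfl
  | succ i ih =>
    rw [Function.iterate_succ_apply, jetDeriv, MvPolynomial.mkDerivation_X, ← jetDeriv, ih]
    congr 2
    omega

/-- The series `∑_{k ≥ 0} 𝔯_{k+1} ε^{2k}`. -/
def jetSeries : JetAlgebra⟦X⟧ :=
  PowerSeries.mk fun n => if Even n then MvPolynomial.X (n / 2 + 1, 0) else 0

/-- Evaluation of the jets on functions at a point. -/
def jetEval (𝔯 : ℕ → ℝ → ℝ) (x : ℝ) : JetAlgebra →ₐ[ℝ] ℝ :=
  MvPolynomial.aeval fun p => iteratedDeriv p.2 (𝔯 p.1) x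

theorem jetEval_iterate_coeff (rc : ℝ) (𝔯 : ℕ → ℝ → ℝ) (x : ℝ) (j l : ℕ) :
    jetEval 𝔯 x (jetDeriv^[j] (coeff l (scaledRecurrence rc jetSeries))) =
      iteratedDeriv j (coeff l (recurrenceSeries rc 𝔯)) x := by
  rw [scaledRecurrence, recurrenceSeries, coeff_mk, map_add, PowerSeries.algebraMap_apply]
  rcases l with _ | _ | l
  · rcases j with _ | j
    · simp [coeff_X_pow_mul']
    · simp [coeff_X_pow_mul', Function.iterate_succ_apply, iteratedDeriv_const]
  · simp [coeff_X_pow_mul']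
  · have hl : Even (l + 1 + 1) ↔ Even l := by
      rw [add_assoc]
      simp [Nat.even_add]
    rw [if_neg (by omega), show l + 1 + 1 = l + 2 by ring, coeff_X_pow_mul, coeff_C,
      if_neg (by omega), zero_add, jetSeries, coeff_mk]
    by_cases h : Even l
    · rw [if_pos h, if_pos (hl.2 h), iterate_jetDeriv_X, zero_add, jetEval, MvPolynomial.aeval_X,
        show (l + 2) / 2 = l / 2 + 1 by omega]
    · rw [if_neg h, if_neg (fun h' => h (hl.1 h')), iterate_map_zero, map_zero]
      exact (by simp : (0 : ℝ) = iteratedDeriv j (fun _ : ℝ => (0 : ℝ)) x)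

/-- Evaluating the jets turns the translation of the universal series into the Taylor shift of the
function-valued one; no smoothness is needed, since only jets of the coefficients of the series
itself occur. -/
theorem map_jetEval_translate (rc : ℝ) (𝔯 : ℕ → ℝ → ℝ) (x : ℝ) (i : ℤ) :
    PowerSeries.map (jetEval 𝔯 x : JetAlgebra →+* ℝ)
        (translate jetDeriv i (scaledRecurrence rc jetSeries)) =
      PowerSeries.map (Pi.evalRingHom (fun _ : ℝ => ℝ) x) (shift i (recurrenceSeries rc 𝔯)) := by
  ext n
  rw [PowerSeries.coeff_map, PowerSeries.coeff_map, coeff_translate, shift, coeff_mk,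
    Finset.Nat.sum_antidiagonal_eq_sum_range_succ (fun j l => ((i : ℝ) ^ j / (j ! : ℕ)) •
      jetDeriv^[j] (coeff l (scaledRecurrence rc jetSeries))), map_sum, map_sum]
  refine Finset.sum_congr rfl fun j _ => ?_
  change jetEval 𝔯 x (((i : ℝ) ^ j / (j ! : ℕ)) •
    jetDeriv^[j] (coeff (n - j) (scaledRecurrence rc jetSeries))) = _
  rw [map_smul, jetEval_iterate_coeff]
  rfl

theorem coeff_generatingFunction_apply (rc : ℝ) (𝔯 : ℕ → ℝ → ℝ) (x : ℝ) (k n : ℕ) :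
    coeff n (coeff k (generatingFunction (recurrenceSeries rc 𝔯))) x =
      jetEval 𝔯 x (coeff n (coeff k (diagonalResolvent
        (fun i : ℤ => translate jetDeriv i (scaledRecurrence rc jetSeries)) 0))) := by
  have h := congrArg (fun F => coeff n (coeff k F)) (map_diagonalResolvent
    (PowerSeries.map (jetEval 𝔯 x : JetAlgebra →+* ℝ))
    (fun i : ℤ => translate jetDeriv i (scaledRecurrence rc jetSeries)) 0)
  have h' := congrArg (fun F => coeff n (coeff k F)) (map_diagonalResolvent
    (PowerSeries.map (Pi.evalRingHom (fun _ : ℝ => ℝ) x))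
    (fun i : ℤ => shift i (recurrenceSeries rc 𝔯)) 0)
  simp only [map_jetEval_translate, PowerSeries.coeff_map] at h h'
  rw [generatingFunction_eq]
  exact h'.trans h.symm

theorem contour_derivative_potential (p : ℕ) (g : ℕ → ℝ) (U : ScaledSeries⟦X⟧) :
    contour (Polynomial.derivative (potential p g)) U =
      ∑ k ∈ Finset.Icc 1 p, (k * g k) • coeff k U := by
  have hadd : ∀ P Q : Polynomial ℝ, contour (P + Q) U = contour P U + contour Q U := by
    intro P Q
    exact Polynomial.sum_add_index P Q _ (fun _ => zero_smul _ _) fun _ _ _ => add_smul _ _ _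
  have hsum : ∀ (s : Finset ℕ) (P : ℕ → Polynomial ℝ),
      contour (∑ k ∈ s, P k) U = ∑ k ∈ s, contour (P k) U := by
    intro s P
    induction s using Finset.induction_on with
    | empty => simp [contour]
    | insert a s ha ih => rw [Finset.sum_insert ha, Finset.sum_insert ha, hadd, ih]
  rw [potential, map_sum, hsum]
  refine Finset.sum_congr rfl fun k hk => ?_
  obtain ⟨j, rfl⟩ : ∃ j, k = j + 1 := ⟨k - 1, by have := Finset.mem_Icc.1 hk; omega⟩
  rw [Polynomial.derivative_C_mul_X_pow, contour, Polynomial.C_mul_X_pow_eq_monomial]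
  refine (Polynomial.sum_monomial_index _ (fun j a => a • coeff (j + 1) U) (zero_smul _ _)).trans ?_
  rw [mul_comm]
  rfl

/-- The derivatives of the hodograph function are the contour integrals of the critical
resolvents. -/
theorem iteratedDeriv_hodograph (p : ℕ) (g : ℕ → ℝ) (rc : ℝ) (k : ℕ) :
    iteratedDeriv k (hodograph p g) rc = 2 ^ k * ((2 * k - 1)‼ : ℕ) *
      ∑ j ∈ Finset.Icc 1 p, (j * g j) * coeff j (binomialSeries rc k) := by
  have hD : ((2 * k - 1)‼ : ℝ) ≠ 0 := by
    exact_mod_cast (Nat.doubleFactorial_pos _).ne'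
  have h : hodograph p g =
      fun r => ∑ j ∈ Finset.Icc 1 p, (((2 * j).choose j : ℝ) * j * g j) * r ^ j := rfl
  rw [h, iteratedDeriv_fun_sum fun j _ => by fun_prop, Finset.mul_sum]
  refine Finset.sum_congr rfl fun j _ => ?_
  rw [iteratedDeriv_const_mul_field, iteratedDeriv_pow, coeff_binomialSeries]
  field_simp

/-- The specialization of differential polynomials in `u` to a differential algebra. -/
def jetSpecialization {A : Type*} [CommRing A] [Algebra ℝ A] (D : Derivation ℝ A A) (u : A) :
    DiffPoly →ₐ[ℝ] A :=
  MvPolynomial.aeval fun i => D^[i] u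

theorem jetSpecialization_totalDeriv {A : Type*} [CommRing A] [Algebra ℝ A]
    (D : Derivation ℝ A A) (u : A) (P : DiffPoly) :
    jetSpecialization D u (totalDeriv P) = D (jetSpecialization D u P) := by
  induction P using MvPolynomial.induction_on with
  | C a => simp [totalDeriv, jetSpecialization]
  | add p q hp hq => simp [hp, hq]
  | mul_X p i hp =>
    have hX : ∀ i, jetSpecialization D u (MvPolynomial.X i) = D^[i] u := fun i =>
      MvPolynomial.aeval_X _ _
    simp only [Derivation.leibniz, map_add, map_mul, smul_eq_mul, hp, totalDeriv_X, hX,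
      Function.iterate_succ_apply']

/-- At `ε = 0` the solution of the scaled resolvent equation is the generating series of the
Gel'fand–Dikii polynomials, evaluated at `u = ρ|_{ε = 0}`. -/
theorem constantCoeff_coeff_eq_jetSpecialization {A : Type*} [CommRing A] [Algebra ℝ A]
    (D : Derivation ℝ A A) {rc : ℝ} {ρ : A⟦X⟧} {Y : A⟦X⟧⟦X⟧}
    (hY1 : constantCoeff Y = 1) (hY2 : Y ^ 2 = 1 + X * scaledOperator D rc ρ Y)
    {R : DiffPoly⟦X⟧} (hR1 : constantCoeff R = 1)
    (hR2 : R ^ 2 = 1 + X * gelfandDikiiOperator rc totalDeriv (MvPolynomial.X 0) R) (n : ℕ) :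
    constantCoeff (coeff n Y) = jetSpecialization D (constantCoeff ρ) (coeff n R) := by
  set ι : DiffPoly →+* A := (jetSpecialization D (constantCoeff ρ) : DiffPoly →+* A) with hι
  have hιD : ∀ Z : DiffPoly⟦X⟧, PowerSeries.map ι (coeffMap totalDeriv Z) =
      coeffMap D (PowerSeries.map ι Z) := by
    intro Z
    ext1 k
    rw [PowerSeries.coeff_map, coeff_coeffMap, coeff_coeffMap, PowerSeries.coeff_map]
    exact jetSpecialization_totalDeriv D _ _
  have hιu : ι (MvPolynomial.X 0) = constantCoeff ρ := MvPolynomial.aeval_X _ _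
  have hιc : ι (algebraMap ℝ DiffPoly rc) = algebraMap ℝ A rc :=
    (jetSpecialization D (constantCoeff ρ)).commutes rc
  have h : PowerSeries.map constantCoeff Y = PowerSeries.map ι R := by
    refine sq_eq_unique (causal_gelfandDikiiOperator rc D (constantCoeff ρ)) ?_ ?_ ?_ ?_
    · rw [← coeff_zero_eq_constantCoeff_apply, PowerSeries.coeff_map,
        coeff_zero_eq_constantCoeff_apply, hY1, map_one]
    · rw [← map_pow, hY2, map_add, map_one, map_mul, PowerSeries.map_X,
        map_constantCoeff_scaledOperator]
    · rw [← coeff_zero_eq_constantCoeff_apply, PowerSeries.coeff_map,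
        coeff_zero_eq_constantCoeff_apply, hR1, map_one]
    · rw [← map_pow, hR2, map_add, map_one, map_mul, PowerSeries.map_X]
      simp only [gelfandDikiiOperator, map_add, map_sub, map_mul, map_ofNat, hιD,
        PowerSeries.map_C, hιu, hιc]
  have := congrArg (coeff n) h
  rwa [PowerSeries.coeff_map, PowerSeries.coeff_map] at this

theorem jetEval_jetSpecialization (𝔯 : ℕ → ℝ → ℝ) (x : ℝ) (P : DiffPoly) :
    jetEval 𝔯 x (jetSpecialization jetDeriv (constantCoeff jetSeries) P) = P.evalAt (𝔯 1) x := by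
  have h0 : constantCoeff jetSeries = MvPolynomial.X (1, 0) := by
    rw [← coeff_zero_eq_constantCoeff_apply, jetSeries, coeff_mk]
    simp
  have h : (jetEval 𝔯 x).comp (jetSpecialization jetDeriv (constantCoeff jetSeries)) =
      MvPolynomial.aeval fun i => iteratedDeriv i (𝔯 1) x := by
    refine MvPolynomial.algHom_ext fun i => ?_
    rw [AlgHom.comp_apply, jetSpecialization, MvPolynomial.aeval_X, MvPolynomial.aeval_X, h0,
      iterate_jetDeriv_X, zero_add, jetEval, MvPolynomial.aeval_X]
  rw [← AlgHom.comp_apply, h]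
  rfl

end DoubleScaling

end

theorem theorem2 (p : ℕ) (hp : 1 ≤ p) (g : ℕ → ℝ) (hg : 0 < g p)
    (rc Tc : ℝ) (m : ℕ) (hsing : IsSingularSolution (hodograph p g) rc Tc m)
    (Ω : Set ℝ) (hΩ : IsOpen Ω)
    (𝔯 : ℕ → ℝ → ℝ) (hsmooth : ∀ k, 1 ≤ k → ContDiffOn ℝ ∞ (𝔯 k) Ω)
    (hstring : StringEquation (potential p g) Tc m Ω (recurrenceSeries rc 𝔯)) :
    (∃! R : ℕ → DiffPoly, IsGelfandDikii rc R) ∧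
      ∀ R : ℕ → DiffPoly, IsGelfandDikii rc R →
        ∀ x ∈ Ω, criticalConst (hodograph p g) rc m * (R m).evalAt (𝔯 1) x = x := by
  obtain ⟨R, hR1, hR2⟩ := exists_sq_eq
    (causal_gelfandDikiiOperator rc totalDeriv (MvPolynomial.X 0))
  have hR := isGelfandDikii_coeff rc hR1 hR2
  refine ⟨⟨_, hR, fun S hS => hS.unique hR⟩, fun S hS x hx => ?_⟩
  rw [hS.unique hR]
  obtain ⟨Y, hY1, hY2⟩ := exists_sq_eq (causal_scaledOperator jetDeriv rc jetSeries)
  have hm := hsing.two_le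
  -- The left-hand side of the string equation at order `ε^(2m)`, expanded in the critical
  -- resolvents.
  have hleft : PowerSeries.coeff (2 * m) (contour (Polynomial.derivative (potential p g))
      (generatingFunction (recurrenceSeries rc 𝔯))) x =
      ∑ k ∈ Finset.range (m + 1), criticalConst (hodograph p g) rc k *
        jetEval 𝔯 x (PowerSeries.coeff (2 * m - 2 * k) (PowerSeries.coeff k Y)) := by
    have hcoeff : ∀ (c : ℝ) (F : ScaledSeries),
        PowerSeries.coeff (2 * m) (c • F) x = c * PowerSeries.coeff (2 * m) F x := by
      intro c F
      rfl
    rw [contour_derivative_potential, map_sum, Finset.sum_apply]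
    simp only [hcoeff, coeff_generatingFunction_apply, coeff_coeff_diagonalResolvent hY1 hY2,
      map_sum, map_smul, smul_eq_mul, Finset.mul_sum]
    rw [Finset.sum_comm]
    refine Finset.sum_congr rfl fun k _ => ?_
    have hD : ((2 * k - 1).doubleFactorial : ℝ) ≠ 0 := by
      exact_mod_cast (Nat.doubleFactorial_pos _).ne'
    rw [criticalConst, iteratedDeriv_hodograph, mul_div_cancel_left₀ _ (by positivity),
      Finset.sum_mul]
    exact Finset.sum_congr rfl fun j _ => (mul_assoc _ _ _).symm
  -- Only the term `k = m` survives: the constants with `1 ≤ k < m` vanish at a singular solution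
  -- of order `m`, and the zeroth coefficient of `Y` is `1`, which has no term `ε^(2m)`.
  have hY0 : PowerSeries.coeff 0 Y = 1 := by
    rw [PowerSeries.coeff_zero_eq_constantCoeff_apply, hY1]
  have hzero : ∀ k ∈ Finset.range m, criticalConst (hodograph p g) rc k *
      jetEval 𝔯 x (PowerSeries.coeff (2 * m - 2 * k) (PowerSeries.coeff k Y)) = 0 := by
    intro k hk
    rcases Nat.eq_zero_or_pos k with rfl | hk0
    · rw [hY0, PowerSeries.coeff_one, if_neg (by omega), map_zero, mul_zero]
    · rw [criticalConst, hsing.vanish k hk0 (Finset.mem_range.1 hk), zero_div, zero_mul]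
  have hright : PowerSeries.coeff (2 * m) (PowerSeries.C (fun _ => Tc) +
      PowerSeries.X ^ (2 * m) * PowerSeries.C (fun y => y) : ScaledSeries) x = x := by
    rw [map_add, PowerSeries.coeff_C, if_neg (by omega), PowerSeries.coeff_X_pow_mul',
      if_pos le_rfl, Nat.sub_self, PowerSeries.coeff_zero_C, zero_add]
  have hx' := hstring (2 * m) x hx
  rw [hright, hleft, Finset.sum_range_succ, Finset.sum_eq_zero hzero, zero_add, Nat.sub_self,
    PowerSeries.coeff_zero_eq_constantCoeff_apply,
    constantCoeff_coeff_eq_jetSpecialization jetDeriv hY1 hY2 hR1 hR2,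
    jetEval_jetSpecialization] at hx'
  exact hx'
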